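/- **Theorem (Amplification by shuffling).** A randomized algorithm $M$ with inputs in a set $X$ carrying an adjacency relation and outputs in a measurable space $Y$ is called $(\varepsilon,\delta)$-differentially private (DP) if $\Pr[M(x)\in T]\le e^{\varepsilon}\Pr[M(x')\in T]+\delta$ for all adjacent $x,x'\in X$ and all measurable $T\subseteq Y$; $\varepsilon$-DP means $(\varepsilon,0)$-DP. Let $n>1$ be an integer, let $\mathcal D$ be a set and let $\mathcal S^{(1)},\dots,\mathcal S^{(n)}$ be measurable spaces. For $i\in[n]$ let $\mathcal A^{(i)}_{\mathsf{ldp}}\colon \mathcal S^{(1)}\times\cdots\times\mathcal S^{(i-1)}\times\mathcal D\to\mathcal S^{(i)}$ be a randomized algorithm (for every fixed $x\in\mathcal D$, a Markov kernel from $\mathcal S^{(1)}\times\cdots\times\mathcal S^{(i-1)}$ to $\mathcal S^{(i)}$). Let $\varepsilon_0,\delta>0$ and suppose that for every $i$ and every value $z_{1:i-1}$ of the auxiliary inputs, the algorithm $x\mapsto\mathcal A^{(i)}_{\mathsf{ldp}}(z_{1:i-1};x)$ is $\varepsilon_0$-DP, where any two elements of $\mathcal D$ are adjacent. Let $\mathcal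 A_{\mathsf{sl}}\colon\mathcal D^n\to\mathcal S^{(1)}\times\cdots\times\mathcal S^{(n)}$ be the algorithm that, given $x_{1:n}\in\mathcal D^n$, samples a uniformly random permutation $\pi$ of $[n]$, then sequentially draws $z_i\leftarrow\mathcal A^{(i)}_{\mathsf{ldp}}(z_{1:i-1};x_{\pi(i)})$ for $i=1,\dots,n$ (with fresh randomness), and outputs $z_{1:n}$. Call two datasets in $\mathcal D^n$ adjacent if they differ in at most one element, and put $$\varepsilon_1=\frac{2e^{2\varepsilon_0}(e^{\varepsilon_0}-1)}{n}.$$ Then, with respect to this adjacency, the following hold, where $\log$ is the natural logarithm (and, when $\delta>1$, the square roots, whose arguments are then negative, are read as $0$): 1. $\mathcal A_{\mathsf{sl}}$ is $(\varepsilon,\delta)$-DP for $\varepsilon=\varepsilon_1\sqrt{2n\log(1/\delta)}+n\varepsilon_1(e^{\varepsilon_1}-1)$. 2. If $\varepsilon_0\le\ln(n/4)/3$, then $\mathcal A_{\mathsf{sl}}$ is $(\varepsilon,\delta)$-DP for $$\varepsilon=e^{2\varepsilon_0}(e^{\varepsilon_0}-1)\sqrt{\frac{8\log(1/\delta)}{n}}+\frac{6e^{4\varepsilon_0}(e^{\varepsilon_0}-1)^2}{n}.$$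 3. If $n\ge 1000$, $\varepsilon_0<1/2$ and $\delta<1/100$, then $\mathcal A_{\mathsf{sl}}$ is $(\varepsilon,\delta)$-DP for $\varepsilon=12\,\varepsilon_0\sqrt{\log(1/\delta)/n}$. -/

import Mathlib

open MeasureTheory ProbabilityTheory
open scoped ENNReal

namespace ShuffleDP

/-- `(ε, δ)`-differential privacy of a randomized algorithm with inputs in `X` and outputs in `Y`,
with respect to the adjacency relation `adj` on inputs. The algorithm is given by the law `M x` of
its output on each input `x`. -/
def IsDP {X Y : Type*} [MeasurableSpace Y] (adj : X → X → Prop) (M : X → Measure Y)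
    (ε δ : ℝ) : Prop :=
  ∀ x x' : X, adj x x' → ∀ T : Set Y, MeasurableSet T →
    M x T ≤ ENNReal.ofReal (Real.exp ε) * M x' T + ENNReal.ofReal δ

/-- Two datasets of length `n` are adjacent if they differ in (at most) one element. -/
def Adjacent {n : ℕ} {𝒟 : Type*} (x x' : Fin n → 𝒟) : Prop :=
  ∃ i : Fin n, ∀ j : Fin n, j ≠ i → x j = x' j

/-- The product of the first `k` of the output spaces `S 0, …, S (n - 1)`. -/
abbrev Prefix {n : ℕ} (S : Fin n → Type*) (k : ℕ) (hk : k ≤ n) : Type _ :=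
  ∀ j : Fin k, S (Fin.castLE hk j)

/-- A sequence of `n` adaptively chosen local randomizers. The `i`-th one takes the previous outputs
`z 0, …, z (i - 1)` (its auxiliary input) and one data element `x : 𝒟`, and produces a random element
of `S i`, whose law is `A i x z`. No σ-algebra on `𝒟` is needed. -/
abbrev LocalRandomizers {n : ℕ} (𝒟 : Type*) (S : Fin n → Type*) [∀ i, MeasurableSpace (S i)] :
    Type _ :=
  ∀ i : Fin n, 𝒟 → Kernel (Prefix S i i.is_lt.le) (S i)

/-- Append one more output to a sequence of outputs. -/
def extend {n : ℕ} {S : Fin n → Type*} (k : ℕ) (hk : k + 1 ≤ n)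
    (p : Prefix S k (Nat.le_of_succ_le hk) × S ⟨k, hk⟩) : Prefix S (k + 1) hk :=
  Fin.snoc (α := fun j : Fin (k + 1) => S (Fin.castLE hk j)) p.1 p.2

lemma measurable_extend {n : ℕ} {S : Fin n → Type*} [∀ i, MeasurableSpace (S i)]
    (k : ℕ) (hk : k + 1 ≤ n) : Measurable (extend (S := S) k hk) := by
  refine measurable_pi_lambda _ fun j => ?_
  refine Fin.lastCases ?_ (fun j => ?_) j
  · simp only [extend, Fin.snoc_last]
    exact measurable_snd
  · simp only [extend, Fin.snoc_castSucc]
    exact (measurable_pi_apply j).comp measurable_fst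

/-- The joint law of the first `k` outputs when the local randomizers are applied sequentially to the
dataset `x`: given the previous outputs `z`, the next output is drawn from `A k (x k) z`. -/
noncomputable def localPrefixLaw {n : ℕ} {𝒟 : Type*} {S : Fin n → Type*}
    [∀ i, MeasurableSpace (S i)] (A : LocalRandomizers 𝒟 S) (x : Fin n → 𝒟) :
    (k : ℕ) → (hk : k ≤ n) → Measure (Prefix S k hk)
  | 0, _ => Measure.dirac (fun j => j.elim0)
  | k + 1, hk =>
      (localPrefixLaw A x k (Nat.le_of_succ_le hk) ⊗ₘ A ⟨k, hk⟩ (x ⟨k, hk⟩)).map (extend k hk)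

/-- The law of the output `(z 0, …, z (n - 1))` of the algorithm that, for `i = 0, …, n - 1` in
turn, draws `z i` from the `i`-th local randomizer on auxiliary input `(z 0, …, z (i - 1))` and data
element `x i`. -/
noncomputable def localResponses {n : ℕ} {𝒟 : Type*} {S : Fin n → Type*}
    [∀ i, MeasurableSpace (S i)] (A : LocalRandomizers 𝒟 S) (x : Fin n → 𝒟) :
    Measure (∀ i : Fin n, S i) :=
  localPrefixLaw A x n le_rfl

/-- The law of the output of the shuffled algorithm: draw a uniformly random permutation `π` of the
`n` indices and apply the local randomizers sequentially to `(x (π 0), …, x (π (n - 1)))`. -/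
noncomputable def shuffledResponses {n : ℕ} {𝒟 : Type*} {S : Fin n → Type*}
    [∀ i, MeasurableSpace (S i)] (A : LocalRandomizers 𝒟 S) (x : Fin n → 𝒟) :
    Measure (∀ i : Fin n, S i) :=
  (Fintype.card (Equiv.Perm (Fin n)) : ℝ≥0∞)⁻¹ •
    ∑ π : Equiv.Perm (Fin n), localResponses A (fun i => x (π i))

instance isProbabilityMeasure_localPrefixLaw {n : ℕ} {𝒟 : Type*} {S : Fin n → Type*}
    [∀ i, MeasurableSpace (S i)] (A : LocalRandomizers 𝒟 S) [∀ i x, IsMarkovKernel (A i x)]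
    (x : Fin n → 𝒟) (k : ℕ) (hk : k ≤ n) : IsProbabilityMeasure (localPrefixLaw A x k hk) := by
  induction k with
  | zero => unfold localPrefixLaw; infer_instance
  | succ k ih =>
    have := ih (Nat.le_of_succ_le hk)
    unfold localPrefixLaw
    exact Measure.isProbabilityMeasure_map (measurable_extend k hk).aemeasurable

end ShuffleDP

/-!
A uniformly random permutation is a uniformly random permutation fixing the index `0`, followed by a
transposition `swap 0 j` with `j` uniform (`sum_perm_eq_sum_sum_swap`). By symmetry the two data sets
may be assumed to differ at index `0` only, so it suffices to treat the algorithm that swaps the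
element at `0` with the one at a uniformly random position `j` and then applies the local
randomizers (`swapPrefixLaw`, `isDP_shuffledResponses_of_swap`).

Conditionally on the outputs before step `k ≠ 0`, the `k`-th output of this algorithm is drawn from
a mixture of the randomizer applied to `x k` and, with the posterior probability `w` of `j = k`, the
randomizer applied to `x 0`. Changing `j` changes the data set before step `k` in at most two places,
so local privacy gives `w ≤ exp (2 * ε₀) / n` (`localPrefixLaw_swap_le`). Hence the mixture is within
a factor `exp (ε₁ / 2)` of the randomizer at `x k`, which is the same for both data sets: every step
is `ε₁`-DP given the past (`exists_kernels_swapPrefixLaw_succ`).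

The adaptive composition of these `n` steps is controlled through moments of the likelihood ratio.
A density with values in `[exp (-ε), exp ε]` and mean `1` has `(l + 1)`-st moment at most
`exp ((l ^ 2 + l) * ε ^ 2 / 2)`, by convexity and a comparison of hyperbolic cosines
(`lintegral_rpow_le_of_mem_Icc`); these bounds multiply along the composition
(`HasMomentLE.compProd`), and a Markov-type inequality turns them into an `(ε, δ)` bound
(`HasMomentLE.apply_le`). Joint densities of the composed laws, rather than densities of the kernels,
are used throughout: the former exist over arbitrary measurable spaces, the latter need not be
jointly measurable. The second and third bounds follow from the first by elementary estimates.
-/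

namespace ShuffleDP

/-! ### Moments of a bounded density -/

lemma sinh_le_mul_cosh {x : ℝ} (hx : 0 ≤ x) : Real.sinh x ≤ x * Real.cosh x := by
  have h : MonotoneOn (fun x : ℝ => x * Real.cosh x - Real.sinh x) (Set.Ici 0) := by
    refine monotoneOn_of_hasDerivWithinAt_nonneg (f' := fun x => x * Real.sinh x) (convex_Ici 0)
      (by fun_prop) (fun x _ => ?_) (fun x hx => ?_)
    · have h : HasDerivAt (fun x : ℝ => x * Real.cosh x - Real.sinh x) _ x :=
        ((hasDerivAt_id x).mul (Real.hasDerivAt_cosh x)).sub (Real.hasDerivAt_sinh x)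
      exact (h.congr_deriv (by simp)).hasDerivWithinAt
    · rw [interior_Ici] at hx
      exact mul_nonneg (le_of_lt hx) (Real.sinh_nonneg_iff.2 (le_of_lt hx))
  have := h (Set.mem_Ici.2 le_rfl) (Set.mem_Ici.2 hx) hx
  simp at this
  linarith

/-- The function `log (cosh x) - x ^ 2 / 2` is antitone on `[0, ∞)`. -/
lemma cosh_le_cosh_mul_exp {x y : ℝ} (hx : 0 ≤ x) (hxy : x ≤ y) :
    Real.cosh y ≤ Real.cosh x * Real.exp ((y ^ 2 - x ^ 2) / 2) := by
  have h : AntitoneOn (fun x : ℝ => Real.cosh x * Real.exp (-(x ^ 2 / 2))) (Set.Ici 0) := by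
    refine antitoneOn_of_hasDerivWithinAt_nonpos
      (f' := fun x => (Real.sinh x - x * Real.cosh x) * Real.exp (-(x ^ 2 / 2))) (convex_Ici 0)
      (by fun_prop) (fun x _ => ?_) (fun x hx => ?_)
    · have h : HasDerivAt (fun x : ℝ => Real.cosh x * Real.exp (-(x ^ 2 / 2))) _ x :=
        (Real.hasDerivAt_cosh x).mul ((((hasDerivAt_id x).pow 2).div_const 2).neg.exp)
      exact (h.congr_deriv (by simp; ring)).hasDerivWithinAt
    · rw [interior_Ici] at hx
      exact mul_nonpos_of_nonpos_of_nonneg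
        (sub_nonpos.2 (sinh_le_mul_cosh (le_of_lt hx))) (Real.exp_pos _).le
  have := h (Set.mem_Ici.2 hx) (Set.mem_Ici.2 (hx.trans hxy)) hxy
  simp only at this
  calc Real.cosh y = Real.cosh y * Real.exp (-(y ^ 2 / 2)) * Real.exp (y ^ 2 / 2) := by
        rw [mul_assoc, ← Real.exp_add]; simp
    _ ≤ Real.cosh x * Real.exp (-(x ^ 2 / 2)) * Real.exp (y ^ 2 / 2) := by gcongr
    _ = _ := by rw [mul_assoc, ← Real.exp_add]; ring_nf

/-- The chord of the convex function `t ↦ t ^ (l + 1)` over `[exp (-ε), exp ε]`, and a bound on its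
height at `t = 1`. -/
lemma exists_affine_bound_rpow {ε l : ℝ} (hε : 0 < ε) (hl : 0 ≤ l) :
    ∃ s d : ℝ, s + d ≤ Real.exp ((l ^ 2 + l) * ε ^ 2 / 2) ∧
      ∀ t ∈ Set.Icc (Real.exp (-ε)) (Real.exp ε), t ^ (l + 1) ≤ s * t + d := by
  set p := Real.exp (-ε)
  set q := Real.exp ε
  have hp : 0 < p := Real.exp_pos _
  have hq : 0 < q := Real.exp_pos _
  have hpq : p < q := Real.exp_lt_exp.2 (by linarith)
  have h1 : p * q = 1 := by simp [p, q, ← Real.exp_add]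
  set P := p ^ (l + 1) with hP
  set Q := q ^ (l + 1) with hQ
  refine ⟨(Q - P) / (q - p), (q * P - p * Q) / (q - p), ?_, ?_⟩
  · -- at `t = 1` the chord has height `cosh ((2 * l + 1) * ε / 2) / cosh (ε / 2)`
    have hP' : P = Real.exp (-ε * (l + 1)) := by rw [hP, ← Real.exp_mul]
    have hQ' : Q = Real.exp (ε * (l + 1)) := by rw [hQ, ← Real.exp_mul]
    have hc := cosh_le_cosh_mul_exp (x := ε / 2) (y := (2 * l + 1) * ε / 2) (by linarith)
      (by nlinarith)
    rw [show (((2 * l + 1) * ε / 2) ^ 2 - (ε / 2) ^ 2) / 2 = (l ^ 2 + l) * ε ^ 2 / 2 by ring] at hc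
    set E := Real.exp ((l ^ 2 + l) * ε ^ 2 / 2)
    rw [← add_div, div_le_iff₀ (by linarith)]
    rw [Real.cosh_eq, Real.cosh_eq] at hc
    set u := Real.exp (ε / 2) with hu
    set v := Real.exp (-(ε / 2)) with hv
    have hup : 0 < u := Real.exp_pos _
    have hvp : 0 < v := Real.exp_pos _
    have hvu : v < u := Real.exp_lt_exp.2 (by linarith)
    have huq : q = u * u := by simp only [q, u, ← Real.exp_add]; ring_nf
    have hvq : p = v * v := by simp only [p, v, ← Real.exp_add]; ring_nf
    have huv : u * v = 1 := by simp only [u, v, ← Real.exp_add]; simp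
    have e1 : Real.exp ((2 * l + 1) * ε / 2) * u = Q := by
      rw [hQ', hu, ← Real.exp_add]; ring_nf
    have e2 : Real.exp ((2 * l + 1) * ε / 2) * v = p * Q := by
      rw [hQ', hv, ← Real.exp_add, ← Real.exp_add]; ring_nf
    have e3 : Real.exp (-((2 * l + 1) * ε / 2)) * v = P := by
      rw [hP', hv, ← Real.exp_add]; ring_nf
    have e4 : Real.exp (-((2 * l + 1) * ε / 2)) * u = q * P := by
      rw [hP', hu, ← Real.exp_add, ← Real.exp_add]; ring_nf
    rw [← e1, ← e3, huq, hvq] at *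
    nlinarith
  · intro t ht
    have ha : 0 ≤ (q - t) / (q - p) := div_nonneg (by linarith [ht.2]) (by linarith)
    have hb : 0 ≤ (t - p) / (q - p) := div_nonneg (by linarith [ht.1]) (by linarith)
    have hab : (q - t) / (q - p) + (t - p) / (q - p) = 1 := by
      have : q - p ≠ 0 := by linarith
      field_simp; ring
    have hconv := (convexOn_rpow (p := l + 1) (by linarith)).2 (Set.mem_Ici.2 hp.le)
      (Set.mem_Ici.2 hq.le) ha hb hab
    have e : ((q - t) / (q - p)) • p + ((t - p) / (q - p)) • q = t := by
      have : q - p ≠ 0 := by linarith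
      simp only [smul_eq_mul]
      field_simp; ring
    rw [e] at hconv
    refine hconv.trans (le_of_eq ?_)
    simp only [smul_eq_mul]
    have : q - p ≠ 0 := by linarith
    field_simp; ring

/-- A density of mean `1` with values in `[exp (-ε), exp ε]` has moments as small as a Gaussian
likelihood ratio would. -/
lemma lintegral_rpow_le_of_mem_Icc {Ω : Type*} [MeasurableSpace Ω] (ν : Measure Ω)
    [IsProbabilityMeasure ν] {ε l : ℝ} (hε : 0 < ε) (hl : 0 ≤ l) {g : Ω → ℝ} (hg : Measurable g)
    (hmem : ∀ ω, g ω ∈ Set.Icc (Real.exp (-ε)) (Real.exp ε))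
    (hint : ∫⁻ ω, ENNReal.ofReal (g ω) ∂ν = 1) :
    ∫⁻ ω, ENNReal.ofReal (g ω) ^ (l + 1) ∂ν ≤
      ENNReal.ofReal (Real.exp ((l ^ 2 + l) * ε ^ 2 / 2)) := by
  obtain ⟨s, d, hsd, hb⟩ := exists_affine_bound_rpow hε hl
  have hpos : ∀ ω, 0 < g ω := fun ω => (Real.exp_pos _).trans_le (hmem ω).1
  have hgi : Integrable g ν :=
    Integrable.of_mem_Icc _ _ hg.aemeasurable (Filter.Eventually.of_forall hmem)
  have hg1 : ∫ ω, g ω ∂ν = 1 := by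
    rw [integral_eq_lintegral_of_nonneg_ae (Filter.Eventually.of_forall fun ω => (hpos ω).le)
      hg.aestronglyMeasurable, hint]
    simp
  calc ∫⁻ ω, ENNReal.ofReal (g ω) ^ (l + 1) ∂ν
      ≤ ∫⁻ ω, ENNReal.ofReal (s * g ω + d) ∂ν := by
        refine lintegral_mono fun ω => ?_
        rw [ENNReal.ofReal_rpow_of_pos (hpos ω)]
        exact ENNReal.ofReal_le_ofReal (hb _ (hmem ω))
    _ = ENNReal.ofReal (∫ ω, (s * g ω + d) ∂ν) := by
        refine (ofReal_integral_eq_lintegral_ofReal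
          ((hgi.const_mul s).add (integrable_const d)) ?_).symm
        refine Filter.Eventually.of_forall fun ω => ?_
        exact (Real.rpow_nonneg (hpos ω).le _).trans (hb _ (hmem ω))
    _ ≤ _ := by
        refine ENNReal.ofReal_le_ofReal ?_
        rw [integral_add (hgi.const_mul s) (integrable_const d), integral_const_mul, hg1]
        simpa using hsd

/-! ### Densities and composition with kernels -/

lemma exists_density_le {Ω : Type*} [MeasurableSpace Ω] {M M' : Measure Ω} [IsFiniteMeasure M]
    [IsFiniteMeasure M'] {c : ℝ≥0∞} (h : M ≤ c • M') :
    ∃ w : Ω → ℝ≥0∞, Measurable w ∧ (∀ ω, w ω ≤ c) ∧ M = M'.withDensity w := by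
  have hac : M ≪ M' := (Measure.absolutelyContinuous_of_le h).trans
    Measure.smul_absolutelyContinuous
  have hle : M.rnDeriv M' ≤ᵐ[M'] fun _ => c := by
    refine ae_le_of_forall_setLIntegral_le_of_sigmaFinite (M.measurable_rnDeriv M')
      fun s hs _ => ?_
    rw [← withDensity_apply _ hs, Measure.withDensity_rnDeriv_eq _ _ hac]
    simpa using h s
  refine ⟨fun ω => min (M.rnDeriv M' ω) c, (M.measurable_rnDeriv M').min measurable_const,
    fun ω => min_le_right _ _, ?_⟩
  conv_lhs => rw [← Measure.withDensity_rnDeriv_eq _ _ hac]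
  refine withDensity_congr_ae ?_
  filter_upwards [hle] with ω hω
  exact (min_eq_left hω).symm

/-- The density is bounded everywhere, not only almost everywhere. -/
lemma exists_density_mem_Icc {Ω : Type*} [MeasurableSpace Ω] {M M' : Measure Ω}
    [IsFiniteMeasure M] [IsFiniteMeasure M'] {ε : ℝ} (hε : 0 ≤ ε)
    (h : M ≤ ENNReal.ofReal (Real.exp ε) • M') (h' : M' ≤ ENNReal.ofReal (Real.exp ε) • M) :
    ∃ g : Ω → ℝ, Measurable g ∧ (∀ ω, g ω ∈ Set.Icc (Real.exp (-ε)) (Real.exp ε)) ∧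
      M = M'.withDensity (fun ω => ENNReal.ofReal (g ω)) := by
  obtain ⟨w, hw, hwle, hM⟩ := exists_density_le h
  have hge : (fun _ => ENNReal.ofReal (Real.exp (-ε))) ≤ᵐ[M'] w := by
    refine ae_le_of_forall_setLIntegral_le_of_sigmaFinite measurable_const fun s hs _ => ?_
    rw [← withDensity_apply w hs, ← hM, setLIntegral_const]
    have := h' s
    simp only [Measure.smul_apply, smul_eq_mul] at this
    calc ENNReal.ofReal (Real.exp (-ε)) * M' s
        ≤ ENNReal.ofReal (Real.exp (-ε)) * (ENNReal.ofReal (Real.exp ε) * M s) := by gcongr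
      _ = M s := by
        rw [← mul_assoc, ← ENNReal.ofReal_mul (Real.exp_pos _).le, ← Real.exp_add]; simp
  refine ⟨fun ω => max (Real.exp (-ε)) (w ω).toReal, measurable_const.max hw.ennreal_toReal,
    fun ω => ⟨le_max_left _ _, max_le (Real.exp_le_exp.2 (by linarith)) ?_⟩, ?_⟩
  · exact ENNReal.toReal_le_of_le_ofReal (Real.exp_pos _).le (hwle ω)
  · conv_lhs => rw [hM]
    refine withDensity_congr_ae ?_
    filter_upwards [hge] with ω hω
    have hfin : w ω ≠ ∞ := ((hwle ω).trans_lt ENNReal.ofReal_lt_top).ne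
    rw [max_eq_right, ENNReal.ofReal_toReal hfin]
    exact (ENNReal.ofReal_le_iff_le_toReal hfin).1 hω

lemma withDensity_compProd_left {Z S : Type*} [MeasurableSpace Z] [MeasurableSpace S]
    (P : Measure Z) [IsFiniteMeasure P] (B : Kernel Z S) [IsMarkovKernel B] {f : Z → ℝ≥0∞}
    (hf : Measurable f) [IsFiniteMeasure (P.withDensity f)] :
    P.withDensity f ⊗ₘ B = (P ⊗ₘ B).withDensity (fun p => f p.1) := by
  ext T hT
  rw [Measure.compProd_apply hT, withDensity_apply _ hT,
    lintegral_withDensity_eq_lintegral_mul _ hf (Kernel.measurable_kernel_prodMk_left hT),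
    ← lintegral_indicator hT, Measure.lintegral_compProd (Measurable.indicator (by fun_prop) hT)]
  refine lintegral_congr fun z => ?_
  have : (fun b => T.indicator (fun p : Z × S => f p.1) (z, b)) =
      (Prod.mk z ⁻¹' T).indicator (fun _ => f z) := rfl
  rw [this, lintegral_indicator (measurable_prodMk_left hT), setLIntegral_const]
  rfl

lemma compProd_le_compProd {Z S : Type*} [MeasurableSpace Z] [MeasurableSpace S]
    {P P' : Measure Z} [SFinite P] [SFinite P'] {B B' : Kernel Z S} [IsMarkovKernel B]
    [IsMarkovKernel B'] {b c : ℝ≥0∞} (hP : P ≤ b • P')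
    (hB : ∀ z T, MeasurableSet T → B z T ≤ c * B' z T) :
    P ⊗ₘ B ≤ (b * c) • (P' ⊗ₘ B') := by
  refine Measure.le_iff.2 fun T hT => ?_
  have hm := Kernel.measurable_kernel_prodMk_left (κ := B') hT
  rw [Measure.smul_apply, smul_eq_mul, Measure.compProd_apply hT, Measure.compProd_apply hT]
  calc ∫⁻ z, B z (Prod.mk z ⁻¹' T) ∂P
      ≤ ∫⁻ z, c * B' z (Prod.mk z ⁻¹' T) ∂(b • P') :=
        lintegral_mono' hP fun z => hB z _ (measurable_prodMk_left hT)
    _ = b * c * ∫⁻ z, B' z (Prod.mk z ⁻¹' T) ∂P' := by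
        rw [lintegral_const_mul _ hm, lintegral_smul_measure, smul_eq_mul]
        ring

lemma compProd_le_of_forall_le {Z S : Type*} [MeasurableSpace Z] [MeasurableSpace S]
    (P : Measure Z) [SFinite P] {B B' : Kernel Z S} [IsMarkovKernel B] [IsMarkovKernel B']
    {c : ℝ≥0∞} (h : ∀ z T, MeasurableSet T → B z T ≤ c * B' z T) : P ⊗ₘ B ≤ c • (P ⊗ₘ B') := by
  simpa using compProd_le_compProd (b := 1) (P := P) (P' := P) (by simp) h

/-- `P` has a density `f` with respect to `Q` whose moment of order `α` satisfies `∫ f ^ α ∂Q ≤ K`.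
For `α > 1` this bounds the Rényi divergence of order `α` of `P` from `Q` by `log K / (α - 1)`. -/
def HasMomentLE {Ω : Type*} [MeasurableSpace Ω] (P Q : Measure Ω) (α : ℝ) (K : ℝ≥0∞) : Prop :=
  ∃ f : Ω → ℝ≥0∞, Measurable f ∧ P = Q.withDensity f ∧ ∫⁻ ω, f ω ^ α ∂Q ≤ K

lemma HasMomentLE.refl {Ω : Type*} [MeasurableSpace Ω] (P : Measure Ω) [IsProbabilityMeasure P]
    (α : ℝ) : HasMomentLE P P α 1 :=
  ⟨fun _ => 1, measurable_const, by simp, by simp⟩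

/-- Moments are preserved by an injection with a measurable left inverse. -/
lemma HasMomentLE.map {Ω Ω' : Type*} [MeasurableSpace Ω] [MeasurableSpace Ω'] {P Q : Measure Ω}
    {α : ℝ} {K : ℝ≥0∞} (h : HasMomentLE P Q α K) {e : Ω → Ω'} {r : Ω' → Ω} (he : Measurable e)
    (hr : Measurable r) (hre : Function.LeftInverse r e) :
    HasMomentLE (P.map e) (Q.map e) α K := by
  obtain ⟨f, hf, hP, hK⟩ := h
  refine ⟨f ∘ r, hf.comp hr, ?_, ?_⟩
  · ext T hT
    rw [Measure.map_apply he hT, withDensity_apply _ hT, hP, withDensity_apply _ (he hT),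
      setLIntegral_map hT (hf.comp hr) he]
    simp [hre _]
  · rw [lintegral_map ((hf.comp hr).pow_const α) he]
    simpa [hre _] using hK

/-- Adaptive composition: appending a step that is `ε`-DP given the past multiplies the moment bound
by that of a single step. -/
lemma HasMomentLE.compProd {Z S : Type*} [MeasurableSpace Z] [MeasurableSpace S]
    {P P' : Measure Z} [IsFiniteMeasure P] [IsFiniteMeasure P'] {B B' : Kernel Z S}
    [IsMarkovKernel B] [IsMarkovKernel B'] {ε l : ℝ} {K : ℝ≥0∞} (hε : 0 < ε) (hl : 0 ≤ l)
    (h : HasMomentLE P P' (l + 1) K)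
    (hB : ∀ z T, MeasurableSet T → B z T ≤ ENNReal.ofReal (Real.exp ε) * B' z T)
    (hB' : ∀ z T, MeasurableSet T → B' z T ≤ ENNReal.ofReal (Real.exp ε) * B z T) :
    HasMomentLE (P ⊗ₘ B) (P' ⊗ₘ B') (l + 1)
      (K * ENNReal.ofReal (Real.exp ((l ^ 2 + l) * ε ^ 2 / 2))) := by
  obtain ⟨f, hf, hP, hK⟩ := h
  obtain ⟨g, hg, hmem, hM⟩ := exists_density_mem_Icc hε.le (compProd_le_of_forall_le P' hB)
    (compProd_le_of_forall_le P' hB')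
  have hg' : Measurable fun p => ENNReal.ofReal (g p) := hg.ennreal_ofReal
  -- both laws have first marginal `P'`, so the conditional mean of `g` given the past is `1`
  have hone : ∀ᵐ z ∂P', ∫⁻ s, ENNReal.ofReal (g (z, s)) ∂(B' z) = 1 := by
    have : (fun z => ∫⁻ s, ENNReal.ofReal (g (z, s)) ∂(B' z)) =ᵐ[P'] fun _ => 1 := by
      refine ae_eq_of_forall_setLIntegral_eq_of_sigmaFinite hg'.lintegral_kernel_prod_right'
        measurable_const fun s hs _ => ?_
      have h1 : (P' ⊗ₘ B) (s ×ˢ Set.univ) = P' s := by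
        rw [Measure.compProd_apply_prod hs MeasurableSet.univ]; simp
      rw [hM, withDensity_apply _ (hs.prod MeasurableSet.univ),
        Measure.setLIntegral_compProd hg' hs MeasurableSet.univ] at h1
      simpa using h1
    exact this
  have : IsFiniteMeasure (P'.withDensity f) := hP ▸ inferInstance
  refine ⟨fun p => ENNReal.ofReal (g p) * f p.1, hg'.mul (hf.comp measurable_fst), ?_, ?_⟩
  · rw [hP, withDensity_compProd_left P' B hf, hM,
      ← withDensity_mul _ hg' (show Measurable fun p : Z × S => f p.1 by fun_prop)]
    rfl
  · have hl1 : 0 ≤ l + 1 := by linarith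
    rw [Measure.lintegral_compProd (by fun_prop)]
    calc ∫⁻ z, ∫⁻ s, (ENNReal.ofReal (g (z, s)) * f z) ^ (l + 1) ∂(B' z) ∂P'
        ≤ ∫⁻ z, f z ^ (l + 1) * ENNReal.ofReal (Real.exp ((l ^ 2 + l) * ε ^ 2 / 2)) ∂P' := by
          refine lintegral_mono_ae ?_
          filter_upwards [hone] with z hz
          simp_rw [ENNReal.mul_rpow_of_nonneg _ _ hl1, mul_comm _ (f z ^ (l + 1))]
          rw [lintegral_const_mul _ (by fun_prop)]
          gcongr
          exact lintegral_rpow_le_of_mem_Icc _ hε hl (hg.comp measurable_prodMk_left)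
            (fun s => hmem (z, s)) hz
      _ ≤ _ := by
          rw [lintegral_mul_const _ (hf.pow_const _)]
          gcongr

/-- A moment bound yields approximate differential privacy. -/
lemma HasMomentLE.apply_le {Ω : Type*} [MeasurableSpace Ω] {P Q : Measure Ω} {l : ℝ} {K : ℝ≥0∞}
    (hl : 0 ≤ l) (h : HasMomentLE P Q (l + 1) K) (ε : ℝ) {T : Set Ω} (hT : MeasurableSet T) :
    P T ≤ ENNReal.ofReal (Real.exp ε) * Q T + ENNReal.ofReal (Real.exp (-(l * ε))) * K := by
  obtain ⟨f, hf, hP, hK⟩ := h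
  -- where `f` exceeds `exp ε`, it is at most `f * (f / exp ε) ^ l`
  have key : ∀ ω, f ω ≤ ENNReal.ofReal (Real.exp ε) +
      ENNReal.ofReal (Real.exp (-(l * ε))) * f ω ^ (l + 1) := by
    intro ω
    rcases le_total (f ω) (ENNReal.ofReal (Real.exp ε)) with h | h
    · exact h.trans le_self_add
    · refine le_trans ?_ le_add_self
      have h2 : ENNReal.ofReal (Real.exp (l * ε)) ≤ f ω ^ l := by
        rw [mul_comm, Real.exp_mul, ← ENNReal.ofReal_rpow_of_pos (Real.exp_pos _)]
        exact ENNReal.rpow_le_rpow h hl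
      calc f ω = ENNReal.ofReal (Real.exp (-(l * ε))) *
            (ENNReal.ofReal (Real.exp (l * ε)) * f ω) := by
            rw [← mul_assoc, ← ENNReal.ofReal_mul (Real.exp_pos _).le, ← Real.exp_add]; simp
        _ ≤ ENNReal.ofReal (Real.exp (-(l * ε))) * (f ω ^ l * f ω) := by gcongr
        _ = _ := by rw [ENNReal.rpow_add_of_nonneg _ _ hl zero_le_one, ENNReal.rpow_one]
  rw [hP, withDensity_apply _ hT]
  calc ∫⁻ ω in T, f ω ∂Q ≤ ∫⁻ ω in T, (ENNReal.ofReal (Real.exp ε) +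
        ENNReal.ofReal (Real.exp (-(l * ε))) * f ω ^ (l + 1)) ∂Q := lintegral_mono key
    _ = ENNReal.ofReal (Real.exp ε) * Q T +
        ENNReal.ofReal (Real.exp (-(l * ε))) * ∫⁻ ω in T, f ω ^ (l + 1) ∂Q := by
      rw [lintegral_add_left measurable_const, lintegral_const_mul _ (hf.pow_const _),
        setLIntegral_const]
    _ ≤ _ := by
      gcongr
      exact (setLIntegral_le_lintegral _ _).trans hK

/-- If `P = R + M`, then drawing from `κ` on the part `R` and from `η` on the part `M` is drawing from
a mixture of `κ` and `η`, in which the weight of `η` is the density of `M` with respect to `P`. -/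
lemma exists_mixture_kernel {Z S : Type*} [MeasurableSpace Z] [MeasurableSpace S]
    {P R M : Measure Z} [IsFiniteMeasure P] [IsFiniteMeasure R] [IsFiniteMeasure M]
    (κ η : Kernel Z S) [IsMarkovKernel κ] [IsMarkovKernel η] (hP : P = R + M) {q : ℝ≥0∞}
    (hM : M ≤ q • P) :
    ∃ (B : Kernel Z S) (w : Z → ℝ≥0∞), IsMarkovKernel B ∧ P ⊗ₘ B = R ⊗ₘ κ + M ⊗ₘ η ∧
      (∀ z, w z ≤ 1 ∧ w z ≤ q) ∧ ∀ z, B z = (1 - w z) • κ z + w z • η z := by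
  have hM1 : M ≤ min 1 q • P := by
    rcases le_total 1 q with h | h
    · rw [min_eq_left h, one_smul, hP]; exact Measure.le_add_left le_rfl
    · rwa [min_eq_right h]
  obtain ⟨w, hw, hwle, hMw⟩ :=
    exists_density_le hM1
  have hw1 : ∀ z, w z ≤ 1 := fun z => (hwle z).trans (min_le_left _ _)
  have hw' : Measurable fun z => 1 - w z := measurable_const.sub hw
  have hR : R = P.withDensity fun z => 1 - w z := by
    have h1 : R + M = P.withDensity (fun z => 1 - w z) + M := by
      conv_rhs => rw [hMw]
      rw [← hP, ← withDensity_add_right _ hw]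
      conv_lhs => rw [← withDensity_one (μ := P)]
      congr 1
      ext z
      exact (tsub_add_cancel_of_le (hw1 z)).symm
    exact (Measure.add_left_inj _ _ _).1 h1
  let B : Kernel Z S :=
    { toFun := fun z => (1 - w z) • κ z + w z • η z
      measurable' := by
        refine Measure.measurable_of_measurable_coe _ fun T hT => ?_
        simp only [Measure.add_apply, Measure.smul_apply, smul_eq_mul]
        exact (hw'.mul (κ.measurable_coe hT)).add (hw.mul (η.measurable_coe hT)) }
  have hBz : ∀ z, B z = (1 - w z) • κ z + w z • η z := fun z => rfl
  have hBm : IsMarkovKernel B := ⟨fun z => ⟨by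
    simp [hBz, tsub_add_cancel_of_le (hw1 z)]⟩⟩
  refine ⟨B, w, hBm, ?_, fun z => ⟨hw1 z, (hwle z).trans (min_le_right _ _)⟩, hBz⟩
  ext T hT
  have mκ := Kernel.measurable_kernel_prodMk_left (κ := κ) hT
  have mη := Kernel.measurable_kernel_prodMk_left (κ := η) hT
  rw [Measure.add_apply, Measure.compProd_apply hT, Measure.compProd_apply hT,
    Measure.compProd_apply hT, hR, hMw, lintegral_withDensity_eq_lintegral_mul _ hw' mκ,
    lintegral_withDensity_eq_lintegral_mul _ hw mη, ← lintegral_add_left (hw'.mul mκ)]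
  exact lintegral_congr fun z => by simp [hBz]

/-! ### The randomly swapped algorithm -/

/-- Here `r`, `s` are the probabilities of an event under two laws that are within a factor `a` of
each other; a mixture giving weight `w ≤ q` to the second law is within a factor
`1 + q * (a - 1) ≤ exp u` of the first. -/
lemma mixture_le_and_le_mixture {w q r s : ℝ≥0∞} {a u : ℝ} (ha : 1 ≤ a) (hw : w ≤ 1)
    (hwq : w ≤ q) (hq : q * ENNReal.ofReal (a - 1) ≤ ENNReal.ofReal u) (hu : 0 ≤ u)
    (hr : r ≠ ∞) (hs : s ≠ ∞)
    (hrs : r ≤ ENNReal.ofReal a * s) (hsr : s ≤ ENNReal.ofReal a * r) :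
    (1 - w) * r + w * s ≤ ENNReal.ofReal (Real.exp u) * r ∧
      r ≤ ENNReal.ofReal (Real.exp u) * ((1 - w) * r + w * s) := by
  have hwu : w * ENNReal.ofReal (a - 1) ≤ ENNReal.ofReal u := le_trans (by gcongr) hq
  have hwt : w ≠ ∞ := ne_top_of_le_ne_top ENNReal.one_ne_top hw
  have h1 : (1 - w) * r + w * s =
      ENNReal.ofReal ((1 - w.toReal) * r.toReal + w.toReal * s.toReal) := by
    have hw' : w.toReal ≤ 1 := ENNReal.toReal_le_of_le_ofReal zero_le_one (by simpa using hw)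
    rw [ENNReal.ofReal_add (mul_nonneg (by linarith) ENNReal.toReal_nonneg) (by positivity),
      ENNReal.ofReal_mul (by linarith), ENNReal.ofReal_mul ENNReal.toReal_nonneg,
      ENNReal.ofReal_sub _ ENNReal.toReal_nonneg, ENNReal.ofReal_toReal hwt,
      ENNReal.ofReal_toReal hr, ENNReal.ofReal_toReal hs, ENNReal.ofReal_one]
  rw [h1]
  have hw0 : 0 ≤ w.toReal := ENNReal.toReal_nonneg
  have hr0 : 0 ≤ r.toReal := ENNReal.toReal_nonneg
  have hs0 : 0 ≤ s.toReal := ENNReal.toReal_nonneg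
  have hw1 : w.toReal ≤ 1 := ENNReal.toReal_le_of_le_ofReal zero_le_one (by simpa using hw)
  have hrs' : r.toReal ≤ a * s.toReal := by
    have := ENNReal.toReal_mono (by finiteness) hrs
    rwa [ENNReal.toReal_mul, ENNReal.toReal_ofReal (by linarith)] at this
  have hsr' : s.toReal ≤ a * r.toReal := by
    have := ENNReal.toReal_mono (by finiteness) hsr
    rwa [ENNReal.toReal_mul, ENNReal.toReal_ofReal (by linarith)] at this
  have hwu' : w.toReal * (a - 1) ≤ u := by
    have := ENNReal.toReal_mono (by finiteness) hwu
    rwa [ENNReal.toReal_mul, ENNReal.toReal_ofReal (by linarith), ENNReal.toReal_ofReal hu] at this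
  have he := Real.add_one_le_exp u
  rw [← ENNReal.ofReal_toReal hr, ← ENNReal.ofReal_mul (Real.exp_pos _).le,
    ← ENNReal.ofReal_mul (Real.exp_pos _).le]
  rw [ENNReal.toReal_ofReal hr0]
  generalize w.toReal = w at *
  generalize r.toReal = r at *
  generalize s.toReal = s at *
  constructor <;> refine ENNReal.ofReal_le_ofReal ?_
  · calc (1 - w) * r + w * s ≤ (1 + w * (a - 1)) * r := by
          nlinarith [mul_le_mul_of_nonneg_left hsr' hw0]
      _ ≤ _ := by gcongr; linarith
  · calc r ≤ (1 + w * (a - 1)) * ((1 - w) * r + w * s) := by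
          -- multiplied by `a`, the difference is at least `w * (1 - w) * (a - 1) ^ 2 * r`
          have h2 : 0 ≤ w * (1 - w) * (a - 1) ^ 2 * r := by
            have : 0 ≤ 1 - w := by linarith
            positivity
          have h3 : 0 ≤ (1 + w * (a - 1)) * w * (a * s - r) := by
            have : 0 ≤ a - 1 := by linarith
            have : 0 ≤ a * s - r := by linarith
            positivity
          nlinarith
      _ ≤ _ := by
          gcongr
          linarith

variable {n : ℕ} {𝒟 : Type*} {S : Fin n → Type*} [∀ i, MeasurableSpace (S i)]

open Classical in
/-- Group privacy: each position among the first `k` at which `y` and `y'` differ costs a factor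
`exp ε₀`. -/
lemma localPrefixLaw_le (A : LocalRandomizers 𝒟 S) [∀ i x, IsMarkovKernel (A i x)] {ε₀ : ℝ}
    (hA : ∀ (i : Fin n) (z : Prefix S i i.is_lt.le),
      IsDP (fun _ _ : 𝒟 => True) (fun x => A i x z) ε₀ 0)
    (y y' : Fin n → 𝒟) (k : ℕ) (hk : k ≤ n) :
    localPrefixLaw A y k hk ≤
      ENNReal.ofReal (Real.exp (ε₀ * (Finset.univ.filter
        fun i : Fin n => i.val < k ∧ y i ≠ y' i).card)) • localPrefixLaw A y' k hk := by
  induction k with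
  | zero => simp [localPrefixLaw]
  | succ k ih =>
    have hstep := ih (Nat.le_of_succ_le hk)
    set i : Fin n := ⟨k, hk⟩ with hi
    unfold localPrefixLaw
    rw [← Measure.map_smul]
    refine Measure.map_mono ?_ (measurable_extend k hk)
    by_cases hy : y i = y' i
    · have hcard : (Finset.univ.filter fun i : Fin n => i.val < k + 1 ∧ y i ≠ y' i) =
          Finset.univ.filter fun i : Fin n => i.val < k ∧ y i ≠ y' i := by
        ext j
        simp only [Finset.mem_filter, Finset.mem_univ, true_and]
        refine ⟨fun h => ⟨lt_of_le_of_ne (Nat.lt_succ_iff.1 h.1) fun hj => ?_, h.2⟩,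
          fun h => ⟨h.1.trans (Nat.lt_succ_self k), h.2⟩⟩
        exact h.2 ((show j = i from Fin.ext hj) ▸ hy)
      rw [hcard, show y ⟨k, hk⟩ = y' ⟨k, hk⟩ from hy]
      simpa using compProd_le_compProd (c := 1) (B := A i (y' i)) hstep
        (fun z T _ => (one_mul (A i (y' i) z T)).ge)
    · have hcard : (Finset.univ.filter fun i : Fin n => i.val < k + 1 ∧ y i ≠ y' i) =
          insert i (Finset.univ.filter fun i : Fin n => i.val < k ∧ y i ≠ y' i) := by
        ext j
        simp only [Finset.mem_filter, Finset.mem_univ, true_and, Finset.mem_insert]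
        constructor
        · intro h
          rcases Nat.lt_succ_iff_lt_or_eq.1 h.1 with h1 | h1
          · exact Or.inr ⟨h1, h.2⟩
          · exact Or.inl (Fin.ext h1)
        · rintro (h | h)
          · subst h; exact ⟨Nat.lt_succ_self k, hy⟩
          · exact ⟨h.1.trans (Nat.lt_succ_self k), h.2⟩
      rw [hcard, Finset.card_insert_of_notMem (by simp [hi])]
      push_cast
      rw [mul_add, mul_one, Real.exp_add, ENNReal.ofReal_mul (Real.exp_pos _).le]
      refine compProd_le_compProd hstep fun z T hT => ?_
      simpa using hA i z (y i) (y' i) trivial T hT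

/-- The law of the first `k` outputs of the algorithm that exchanges the data elements at positions
`0` and `j`, for a uniformly random `j`, and then applies the local randomizers sequentially. -/
noncomputable def swapPrefixLaw [NeZero n] (A : LocalRandomizers 𝒟 S) (x : Fin n → 𝒟) (k : ℕ)
    (hk : k ≤ n) : Measure (Prefix S k hk) :=
  (n : ℝ≥0∞)⁻¹ • ∑ j : Fin n, localPrefixLaw A (fun i => x (Equiv.swap 0 j i)) k hk

instance isProbabilityMeasure_swapPrefixLaw [NeZero n] (A : LocalRandomizers 𝒟 S)
    [∀ i x, IsMarkovKernel (A i x)] (x : Fin n → 𝒟) (k : ℕ) (hk : k ≤ n) :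
    IsProbabilityMeasure (swapPrefixLaw A x k hk) := by
  refine ⟨?_⟩
  simp [swapPrefixLaw, ENNReal.inv_mul_cancel, NeZero.ne n]

/-- The likelihood of the outputs before step `k` under `j = k` exceeds that under any other `j` by at
most `exp (2 * ε₀)`, so the posterior probability of `j = k` is at most `exp (2 * ε₀) / n`. -/
lemma localPrefixLaw_swap_le [NeZero n] (A : LocalRandomizers 𝒟 S)
    [∀ i x, IsMarkovKernel (A i x)] {ε₀ : ℝ} (hε₀ : 0 ≤ ε₀)
    (hA : ∀ (i : Fin n) (z : Prefix S i i.is_lt.le),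
      IsDP (fun _ _ : 𝒟 => True) (fun x => A i x z) ε₀ 0)
    (x : Fin n → 𝒟) (k : ℕ) (hk : k + 1 ≤ n) (j : Fin n) :
    localPrefixLaw A (fun i => x (Equiv.swap 0 ⟨k, hk⟩ i)) k (Nat.le_of_succ_le hk) ≤
      ENNReal.ofReal (Real.exp (2 * ε₀)) •
        localPrefixLaw A (fun i => x (Equiv.swap 0 j i)) k (Nat.le_of_succ_le hk) := by
  classical
  refine (localPrefixLaw_le A hA _ (fun i => x (Equiv.swap 0 j i)) k _).trans ?_
  gcongr ENNReal.ofReal (Real.exp ?_) • _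
  rw [mul_comm]
  gcongr
  -- the two data sets agree on the first `k` positions outside `0` and `j`
  have hsub : (Finset.univ.filter fun i : Fin n =>
      i.val < k ∧ x (Equiv.swap 0 ⟨k, hk⟩ i) ≠ x (Equiv.swap 0 j i)) ⊆ {0, j} := by
    intro i hi
    simp only [Finset.mem_filter, Finset.mem_univ, true_and] at hi
    by_contra h
    simp only [Finset.mem_insert, Finset.mem_singleton, not_or] at h
    refine hi.2 ?_
    rw [Equiv.swap_apply_of_ne_of_ne h.1 (fun h' => by simp [h'] at hi),
      Equiv.swap_apply_of_ne_of_ne h.1 h.2]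
  exact_mod_cast (Finset.card_le_card hsub).trans Finset.card_le_two

lemma finset_sum_compProd {Z Y ι : Type*} [MeasurableSpace Z] [MeasurableSpace Y] (s : Finset ι)
    (μ : ι → Measure Z) [∀ i, IsFiniteMeasure (μ i)] (κ : Kernel Z Y) [IsMarkovKernel κ] :
    (∑ i ∈ s, μ i) ⊗ₘ κ = ∑ i ∈ s, μ i ⊗ₘ κ := by
  ext T hT
  rw [Measure.compProd_apply hT, lintegral_finsetSum_measure, Measure.finsetSum_apply]
  exact Finset.sum_congr rfl fun i _ => (Measure.compProd_apply hT).symm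

lemma swapPrefixLaw_succ [NeZero n] (A : LocalRandomizers 𝒟 S) (x : Fin n → 𝒟) (k : ℕ)
    (hk : k + 1 ≤ n) :
    swapPrefixLaw A x (k + 1) hk = ((n : ℝ≥0∞)⁻¹ • ∑ j : Fin n,
      localPrefixLaw A (fun i => x (Equiv.swap 0 j i)) k (Nat.le_of_succ_le hk) ⊗ₘ
        A ⟨k, hk⟩ (x (Equiv.swap 0 j ⟨k, hk⟩))).map (extend k hk) := by
  rw [swapPrefixLaw, Measure.map_smul]
  congr 1
  ext T hT
  rw [Measure.map_apply (measurable_extend k hk) hT, Measure.finsetSum_apply,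
    Measure.finsetSum_apply]
  exact Finset.sum_congr rfl fun j _ => Measure.map_apply (measurable_extend k hk) hT

/-- For `k ≠ 0`, the conditional law of the `k`-th output of the swapped algorithm is close to the law
of the `k`-th randomizer at `x k`. -/
lemma exists_kernel_swapPrefixLaw_succ [NeZero n] (A : LocalRandomizers 𝒟 S)
    [∀ i x, IsMarkovKernel (A i x)] {ε₀ u : ℝ} (hε₀ : 0 ≤ ε₀)
    (hA : ∀ (i : Fin n) (z : Prefix S i i.is_lt.le),
      IsDP (fun _ _ : 𝒟 => True) (fun x => A i x z) ε₀ 0)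
    (hu : u = Real.exp (2 * ε₀) * (Real.exp ε₀ - 1) / n)
    (x : Fin n → 𝒟) (k : ℕ) (hk0 : k ≠ 0) (hk : k + 1 ≤ n) :
    ∃ B : Kernel (Prefix S k (Nat.le_of_succ_le hk)) (S ⟨k, hk⟩), IsMarkovKernel B ∧
      swapPrefixLaw A x (k + 1) hk =
        (swapPrefixLaw A x k (Nat.le_of_succ_le hk) ⊗ₘ B).map (extend k hk) ∧
      ∀ z T, MeasurableSet T →
        B z T ≤ ENNReal.ofReal (Real.exp u) * A ⟨k, hk⟩ (x ⟨k, hk⟩) z T ∧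
        A ⟨k, hk⟩ (x ⟨k, hk⟩) z T ≤ ENNReal.ofReal (Real.exp u) * B z T := by
  set i : Fin n := ⟨k, hk⟩ with hi
  have hi0 : i ≠ 0 := fun h => hk0 (by simpa [hi] using congrArg Fin.val h)
  have hk' := Nat.le_of_succ_le hk
  set μ : Fin n → Measure (Prefix S k hk') :=
    fun j => localPrefixLaw A (fun i => x (Equiv.swap 0 j i)) k hk' with hμ
  have hn0 : (n : ℝ≥0∞) ≠ 0 := by simp [NeZero.ne n]
  have hnt : (n : ℝ≥0∞) ≠ ∞ := ENNReal.natCast_ne_top n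
  have hnR : (0 : ℝ) < n := by exact_mod_cast NeZero.pos n
  have hfin : ∀ ν : Measure (Prefix S k hk'), IsFiniteMeasure ν →
      IsFiniteMeasure ((n : ℝ≥0∞)⁻¹ • ν) := fun ν hν => ν.smul_finite (by simp [hn0])
  have hfM := hfin (μ i) inferInstance
  have hfR := hfin (∑ j ∈ Finset.univ.erase i, μ j) inferInstance
  have hP : swapPrefixLaw A x k hk' =
      (n : ℝ≥0∞)⁻¹ • (∑ j ∈ Finset.univ.erase i, μ j) + (n : ℝ≥0∞)⁻¹ • μ i := by
    rw [← smul_add, Finset.sum_erase_add _ _ (Finset.mem_univ i)]; rfl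
  have hM : (n : ℝ≥0∞)⁻¹ • μ i ≤
      ((n : ℝ≥0∞)⁻¹ * ENNReal.ofReal (Real.exp (2 * ε₀))) • swapPrefixLaw A x k hk' := by
    rw [mul_smul]
    refine Measure.le_iff.2 fun T _ => ?_
    simp only [Measure.smul_apply, smul_eq_mul, swapPrefixLaw, Measure.finsetSum_apply]
    gcongr
    calc μ i T = (n : ℝ≥0∞)⁻¹ * ∑ _j : Fin n, μ i T := by
          simp [← mul_assoc, ENNReal.inv_mul_cancel hn0 hnt]
      _ ≤ (n : ℝ≥0∞)⁻¹ * ∑ j : Fin n, ENNReal.ofReal (Real.exp (2 * ε₀)) * μ j T := by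
          gcongr with j
          simpa using localPrefixLaw_swap_le A hε₀ hA x k hk j T
      _ = _ := by rw [← Finset.mul_sum]; ring
  obtain ⟨B, w, hB, hcomp, hw, hBz⟩ := exists_mixture_kernel (A i (x i)) (A i (x 0)) hP hM
  refine ⟨B, hB, ?_, fun z T hT => ?_⟩
  · rw [hcomp, swapPrefixLaw_succ]
    congr 1
    rw [Measure.compProd_smul_left, Measure.compProd_smul_left, ← smul_add,
      finset_sum_compProd, ← Finset.sum_erase_add _ _ (Finset.mem_univ i)]
    congr 2
    · refine Finset.sum_congr rfl fun j hj => ?_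
      have hswap : Equiv.swap 0 j ⟨k, hk⟩ = i :=
        Equiv.swap_apply_of_ne_of_ne hi0 (Finset.ne_of_mem_erase hj).symm
      rw [hswap]
    · have hswap : Equiv.swap 0 i ⟨k, hk⟩ = 0 := Equiv.swap_apply_right 0 i
      rw [hswap]
  · rw [hBz z]
    simp only [Measure.add_apply, Measure.smul_apply, smul_eq_mul]
    have ha : 1 ≤ Real.exp ε₀ := Real.one_le_exp hε₀
    refine mixture_le_and_le_mixture ha (hw z).1 (hw z).2 (le_of_eq ?_) ?_
      (measure_ne_top _ _) (measure_ne_top _ _)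
      (by simpa using hA i z (x i) (x 0) trivial T hT)
      (by simpa using hA i z (x 0) (x i) trivial T hT)
    · rw [hu, show ((n : ℝ≥0∞)⁻¹) = ENNReal.ofReal ((n : ℝ)⁻¹) by
        rw [ENNReal.ofReal_inv_of_pos hnR]; simp, ← ENNReal.ofReal_mul (by positivity),
        ← ENNReal.ofReal_mul (by positivity)]
      congr 1
      ring
    · rw [hu]
      have : 0 ≤ Real.exp ε₀ - 1 := by linarith
      positivity

/-- The uniform mixture of finitely many kernels. -/
lemma exists_mean_kernel {Z Y : Type*} [MeasurableSpace Z] [MeasurableSpace Y] [NeZero n]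
    (κ : Fin n → Kernel Z Y) [∀ j, IsMarkovKernel (κ j)] :
    ∃ B : Kernel Z Y, IsMarkovKernel B ∧ (∀ z, B z = (n : ℝ≥0∞)⁻¹ • ∑ j, κ j z) ∧
      ∀ (P : Measure Z) [IsFiniteMeasure P],
        P ⊗ₘ B = (n : ℝ≥0∞)⁻¹ • ∑ j, P ⊗ₘ κ j := by
  let B : Kernel Z Y :=
    { toFun := fun z => (n : ℝ≥0∞)⁻¹ • ∑ j, κ j z
      measurable' := by
        refine Measure.measurable_of_measurable_coe _ fun T hT => ?_
        simp only [Measure.smul_apply, smul_eq_mul, Measure.finsetSum_apply]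
        exact (Finset.measurable_sum _ fun j _ => (κ j).measurable_coe hT).const_mul _ }
  have hBz : ∀ z, B z = (n : ℝ≥0∞)⁻¹ • ∑ j, κ j z := fun z => rfl
  have hB : IsMarkovKernel B := ⟨fun z => ⟨by
    simp [hBz, ENNReal.inv_mul_cancel, NeZero.ne n]⟩⟩
  refine ⟨B, hB, hBz, fun P _ => ?_⟩
  ext T hT
  have hm := fun j => Kernel.measurable_kernel_prodMk_left (κ := κ j) hT
  simp only [Measure.smul_apply, smul_eq_mul, Measure.finsetSum_apply,
    Measure.compProd_apply hT, hBz]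
  rw [lintegral_const_mul _ (Finset.measurable_sum _ fun j _ => hm j),
    lintegral_finsetSum _ fun j _ => hm j]

lemma leftInverse_prefix_split {n : ℕ} {S : Fin n → Type*} (k : ℕ) (hk : k + 1 ≤ n) :
    Function.LeftInverse (fun z : Prefix S (k + 1) hk =>
      ((fun j => z j.castSucc, z (Fin.last k)) : Prefix S k (Nat.le_of_succ_le hk) × S ⟨k, hk⟩))
      (extend k hk) := by
  intro p
  simp only [extend]
  refine Prod.ext (funext fun j => ?_) ?_
  · exact Fin.snoc_castSucc (α := fun j : Fin (k + 1) => S (Fin.castLE hk j)) p.2 p.1 j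
  · exact Fin.snoc_last (α := fun j : Fin (k + 1) => S (Fin.castLE hk j)) p.2 p.1

/-- The step `k = 0`, where the output is drawn from the uniform mixture of the randomizers over the
whole data set, of which one element changes. -/
lemma sum_le_exp_mul_sum [NeZero n] {r r' : Fin n → ℝ} {a : ℝ} (ha : 1 ≤ a)
    (hr' : ∀ j, 0 ≤ r' j) (h : ∀ j, j ≠ 0 → r j = r' j) (h0 : r 0 ≤ a * r' 0)
    (h1 : ∀ j, r' 0 ≤ a * r' j) :
    ∑ j, r j ≤ Real.exp (a * (a - 1) / n) * ∑ j, r' j := by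
  have hn : (0 : ℝ) < n := by exact_mod_cast NeZero.pos n
  have hsum : ∑ j, r j = ∑ j, r' j + (r 0 - r' 0) := by
    rw [← Finset.add_sum_erase _ _ (Finset.mem_univ (0 : Fin n)),
      ← Finset.add_sum_erase _ r' (Finset.mem_univ (0 : Fin n)),
      Finset.sum_congr rfl fun j hj => h j (Finset.ne_of_mem_erase hj)]
    ring
  have hmean : n * r' 0 ≤ a * ∑ j, r' j := by
    rw [Finset.mul_sum]
    simpa using Finset.sum_le_sum fun j (_ : j ∈ Finset.univ) => h1 j
  have hS : 0 ≤ ∑ j, r' j := Finset.sum_nonneg fun j _ => hr' j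
  calc ∑ j, r j ≤ ∑ j, r' j + (a - 1) * r' 0 := by linarith
    _ ≤ ∑ j, r' j + (a - 1) * (a * (∑ j, r' j) / n) := by
        have : 0 ≤ a - 1 := by linarith
        gcongr
        rwa [le_div_iff₀ hn, mul_comm]
    _ = (a * (a - 1) / n + 1) * ∑ j, r' j := by ring
    _ ≤ _ := by gcongr; exact Real.add_one_le_exp _

lemma measurable_prefix_split (k : ℕ) (hk : k + 1 ≤ n) :
    Measurable (fun z : Prefix S (k + 1) hk =>
      ((fun j => z j.castSucc, z (Fin.last k)) : Prefix S k (Nat.le_of_succ_le hk) × S ⟨k, hk⟩)) :=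
  (measurable_pi_lambda _ fun j => measurable_pi_apply j.castSucc).prodMk
    (measurable_pi_apply (Fin.last k))

/-- For data sets that differ at index `0` only, each step of the swapped algorithm is `ε₁`-DP given the
previous outputs. -/
lemma exists_kernels_swapPrefixLaw_succ [NeZero n] (A : LocalRandomizers 𝒟 S)
    [∀ i x, IsMarkovKernel (A i x)] {ε₀ ε₁ : ℝ} (hε₀ : 0 ≤ ε₀)
    (hA : ∀ (i : Fin n) (z : Prefix S i i.is_lt.le),
      IsDP (fun _ _ : 𝒟 => True) (fun x => A i x z) ε₀ 0)
    (hε₁ : ε₁ = 2 * Real.exp (2 * ε₀) * (Real.exp ε₀ - 1) / n)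
    {x x' : Fin n → 𝒟} (hx : ∀ j, j ≠ 0 → x j = x' j) (k : ℕ) (hk : k + 1 ≤ n) :
    ∃ B B' : Kernel (Prefix S k (Nat.le_of_succ_le hk)) (S ⟨k, hk⟩),
      IsMarkovKernel B ∧ IsMarkovKernel B' ∧
      swapPrefixLaw A x (k + 1) hk =
        (swapPrefixLaw A x k (Nat.le_of_succ_le hk) ⊗ₘ B).map (extend k hk) ∧
      swapPrefixLaw A x' (k + 1) hk =
        (swapPrefixLaw A x' k (Nat.le_of_succ_le hk) ⊗ₘ B').map (extend k hk) ∧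
      (∀ z T, MeasurableSet T → B z T ≤ ENNReal.ofReal (Real.exp ε₁) * B' z T) ∧
      ∀ z T, MeasurableSet T → B' z T ≤ ENNReal.ofReal (Real.exp ε₁) * B z T := by
  have ha : 1 ≤ Real.exp ε₀ := Real.one_le_exp hε₀
  rcases eq_or_ne k 0 with rfl | hk0
  · have hi : (⟨0, hk⟩ : Fin n) = 0 := Fin.ext (by simp)
    have hswap : ∀ j : Fin n, Equiv.swap 0 j ⟨0, hk⟩ = j := fun j => by
      rw [hi, Equiv.swap_apply_left]
    have key : ∀ y : Fin n → 𝒟, ∃ B : Kernel (Prefix S 0 (Nat.zero_le n)) (S ⟨0, hk⟩),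
        IsMarkovKernel B ∧
        (∀ z, B z = (n : ℝ≥0∞)⁻¹ • ∑ j, A ⟨0, hk⟩ (y j) z) ∧
        swapPrefixLaw A y (0 + 1) hk =
          (swapPrefixLaw A y 0 (Nat.le_of_succ_le hk) ⊗ₘ B).map (extend 0 hk) := by
      intro y
      obtain ⟨B, hB, hBz, hBP⟩ := exists_mean_kernel fun j => A ⟨0, hk⟩ (y j)
      refine ⟨B, hB, hBz, ?_⟩
      have h0 : swapPrefixLaw A y 0 (Nat.le_of_succ_le hk) =
          Measure.dirac (fun j => j.elim0) := by
        ext T _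
        simp [swapPrefixLaw, localPrefixLaw, ← mul_assoc, ENNReal.inv_mul_cancel, NeZero.ne n]
      rw [h0, hBP, swapPrefixLaw_succ]
      simp only [hswap]
      rfl
    have hle : ∀ (y y' : Fin n → 𝒟), (∀ j, j ≠ 0 → y j = y' j) →
        ∀ (z : Prefix S 0 (Nat.zero_le n)) (T : Set (S ⟨0, hk⟩)), MeasurableSet T →
          (n : ℝ≥0∞)⁻¹ * ∑ j, A ⟨0, hk⟩ (y j) z T ≤ ENNReal.ofReal (Real.exp ε₁) *
            ((n : ℝ≥0∞)⁻¹ * ∑ j, A ⟨0, hk⟩ (y' j) z T) := by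
      intro y y' hy z T hT
      have hreal : ∀ d d' : 𝒟, (A ⟨0, hk⟩ d z).real T ≤
          Real.exp ε₀ * (A ⟨0, hk⟩ d' z).real T := by
        intro d d'
        have := ENNReal.toReal_mono (by finiteness) (hA ⟨0, hk⟩ z d d' trivial T hT)
        simpa [Measure.real, (Real.exp_pos ε₀).le] using this
      have := sum_le_exp_mul_sum (r := fun j => (A ⟨0, hk⟩ (y j) z).real T)
        (r' := fun j => (A ⟨0, hk⟩ (y' j) z).real T) ha (fun j => measureReal_nonneg)
        (fun j hj => by simp only [hy j hj]) (hreal _ _) (fun j => hreal _ _)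
      have hsum : ∀ y : Fin n → 𝒟, ∑ j, A ⟨0, hk⟩ (y j) z T =
          ENNReal.ofReal (∑ j, (A ⟨0, hk⟩ (y j) z).real T) := by
        intro y
        rw [ENNReal.ofReal_sum_of_nonneg fun _ _ => measureReal_nonneg]
        exact Finset.sum_congr rfl fun j _ => (ofReal_measureReal (measure_ne_top _ _)).symm
      rw [mul_left_comm, hsum, hsum, ← ENNReal.ofReal_mul (Real.exp_pos _).le]
      gcongr (n : ℝ≥0∞)⁻¹ * ENNReal.ofReal ?_
      refine this.trans ?_
      gcongr
      rw [hε₁]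
      gcongr ?_ * _ / _
      rw [two_mul ε₀, Real.exp_add]
      nlinarith
    obtain ⟨B, hB, hBz, hBP⟩ := key x
    obtain ⟨B', hB', hBz', hBP'⟩ := key x'
    refine ⟨B, B', hB, hB', hBP, hBP', fun z T hT => ?_, fun z T hT => ?_⟩
    · simpa only [hBz, hBz', Measure.smul_apply, smul_eq_mul, Measure.finsetSum_apply] using
        hle x x' hx z T hT
    · simpa only [hBz, hBz', Measure.smul_apply, smul_eq_mul, Measure.finsetSum_apply] using
        hle x' x (fun j hj => (hx j hj).symm) z T hT
  · obtain ⟨B, hB, hBP, hBz⟩ := exists_kernel_swapPrefixLaw_succ A hε₀ hA rfl x k hk0 hk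
    obtain ⟨B', hB', hBP', hBz'⟩ := exists_kernel_swapPrefixLaw_succ A hε₀ hA rfl x' k hk0 hk
    set u := Real.exp (2 * ε₀) * (Real.exp ε₀ - 1) / n with hu
    have hu2 : ENNReal.ofReal (Real.exp ε₁) =
        ENNReal.ofReal (Real.exp u) * ENNReal.ofReal (Real.exp u) := by
      rw [← ENNReal.ofReal_mul (Real.exp_pos _).le, ← Real.exp_add, hε₁, hu]
      congr 2
      ring
    have hxk : x ⟨k, hk⟩ = x' ⟨k, hk⟩ :=
      hx _ fun h => hk0 (by simpa using congrArg Fin.val h)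
    rw [hxk] at hBz
    refine ⟨B, B', hB, hB', hBP, hBP', fun z T hT => ?_, fun z T hT => ?_⟩
    · rw [hu2, mul_assoc]
      exact (hBz z T hT).1.trans (by gcongr; exact (hBz' z T hT).2)
    · rw [hu2, mul_assoc]
      exact (hBz' z T hT).1.trans (by gcongr; exact (hBz z T hT).2)

lemma hasMomentLE_swapPrefixLaw [NeZero n] (A : LocalRandomizers 𝒟 S)
    [∀ i x, IsMarkovKernel (A i x)] {ε₀ ε₁ l : ℝ} (hε₀ : 0 < ε₀) (hl : 0 ≤ l)
    (hA : ∀ (i : Fin n) (z : Prefix S i i.is_lt.le),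
      IsDP (fun _ _ : 𝒟 => True) (fun x => A i x z) ε₀ 0)
    (hε₁ : ε₁ = 2 * Real.exp (2 * ε₀) * (Real.exp ε₀ - 1) / n)
    {x x' : Fin n → 𝒟} (hx : ∀ j, j ≠ 0 → x j = x' j) (k : ℕ) (hk : k ≤ n) :
    HasMomentLE (swapPrefixLaw A x k hk) (swapPrefixLaw A x' k hk) (l + 1)
      (ENNReal.ofReal (Real.exp ((l ^ 2 + l) * ε₁ ^ 2 / 2)) ^ k) := by
  have hn : (0 : ℝ) < n := by exact_mod_cast NeZero.pos n
  have hε₁pos : 0 < ε₁ := by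
    have := Real.one_lt_exp_iff.2 hε₀
    have : 0 < Real.exp ε₀ - 1 := by linarith
    rw [hε₁]; positivity
  induction k with
  | zero =>
    rw [pow_zero]
    exact HasMomentLE.refl _ _
  | succ k ih =>
    obtain ⟨B, B', hB, hB', hP, hP', h, h'⟩ :=
      exists_kernels_swapPrefixLaw_succ A hε₀.le hA hε₁ hx k hk
    rw [hP, hP', pow_succ]
    exact ((ih (Nat.le_of_succ_le hk)).compProd hε₁pos hl h h').map (measurable_extend k hk)
      (measurable_prefix_split k hk) (leftInverse_prefix_split k hk)

/-! ### From swapping to shuffling -/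

lemma shuffledResponses_comp (A : LocalRandomizers 𝒟 S) (x : Fin n → 𝒟)
    (τ : Equiv.Perm (Fin n)) :
    shuffledResponses A (fun i => x (τ i)) = shuffledResponses A x := by
  unfold shuffledResponses
  congr 1
  exact Equiv.sum_comp (Equiv.mulLeft τ) fun π => localResponses A fun i => x (π i)

/-- Every permutation is uniquely `σ * swap 0 j` with `σ` fixing `0`. -/
lemma sum_perm_eq_sum_sum_swap {m : ℕ} {M : Type*} [AddCommMonoid M]
    (F : Equiv.Perm (Fin (m + 1)) → M) :
    ∑ π, F π = ∑ e : Equiv.Perm (Fin m), ∑ j : Fin (m + 1),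
      F ((Equiv.Perm.decomposeFin.symm (0, e))⁻¹ * Equiv.swap 0 j) := by
  have hdec : ∀ (j : Fin (m + 1)) (e : Equiv.Perm (Fin m)),
      Equiv.Perm.decomposeFin.symm (j, e) =
        Equiv.swap 0 j * Equiv.Perm.decomposeFin.symm (0, e) := by
    intro j e
    ext i
    refine Fin.cases ?_ (fun i => ?_) i <;> simp
  rw [← Equiv.sum_comp (Equiv.inv (Equiv.Perm (Fin (m + 1)))) F,
    ← Equiv.sum_comp Equiv.Perm.decomposeFin.symm, Fintype.sum_prod_type, Finset.sum_comm]
  refine Finset.sum_congr rfl fun e _ => Finset.sum_congr rfl fun j _ => ?_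
  rw [hdec, Equiv.inv_apply, mul_inv_rev, Equiv.swap_inv]

lemma isDP_shuffledResponses_of_swap [NeZero n] (A : LocalRandomizers 𝒟 S) {ε δ : ℝ}
    (h : ∀ x x' : Fin n → 𝒟, (∀ j, j ≠ 0 → x j = x' j) → ∀ T, MeasurableSet T →
      swapPrefixLaw A x n le_rfl T ≤
        ENNReal.ofReal (Real.exp ε) * swapPrefixLaw A x' n le_rfl T + ENNReal.ofReal δ) :
    IsDP Adjacent (shuffledResponses A) ε δ := by
  rintro x x' ⟨i, hi⟩ T hT
  rw [← shuffledResponses_comp A x (Equiv.swap 0 i), ← shuffledResponses_comp A x' (Equiv.swap 0 i)]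
  obtain ⟨m, rfl⟩ := Nat.exists_eq_succ_of_ne_zero (NeZero.ne n)
  let σ : Equiv.Perm (Fin m) → Equiv.Perm (Fin (m + 1)) :=
    fun e => (Equiv.Perm.decomposeFin.symm (0, e))⁻¹
  have hσ : ∀ e, σ e 0 = 0 := fun e => (Equiv.symm_apply_eq _).2 (by simp)
  have hm0 : ((m + 1 : ℕ) : ℝ≥0∞) ≠ 0 := by simp
  have hshuffle : ∀ y : Fin (m + 1) → 𝒟, shuffledResponses A y T =
      (Fintype.card (Equiv.Perm (Fin m)) : ℝ≥0∞)⁻¹ * ∑ e : Equiv.Perm (Fin m),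
        swapPrefixLaw A (fun i => y (σ e i)) (m + 1) le_rfl T := by
    intro y
    simp only [shuffledResponses, swapPrefixLaw, sum_perm_eq_sum_sum_swap, Measure.smul_apply,
      smul_eq_mul, Measure.finsetSum_apply, ← Finset.mul_sum, Fintype.card_perm, Fintype.card_fin,
      Nat.factorial_succ, Nat.cast_mul]
    rw [ENNReal.mul_inv (Or.inl hm0) (Or.inl (ENNReal.natCast_ne_top _)), mul_comm (_)⁻¹ (_)⁻¹,
      mul_assoc]
    rfl
  rw [hshuffle, hshuffle]
  have hc0 : (Fintype.card (Equiv.Perm (Fin m)) : ℝ≥0∞) ≠ 0 := by simp [Fintype.card_ne_zero]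
  calc (Fintype.card (Equiv.Perm (Fin m)) : ℝ≥0∞)⁻¹ * ∑ e : Equiv.Perm (Fin m),
        swapPrefixLaw A (fun j => x (Equiv.swap 0 i (σ e j))) (m + 1) le_rfl T
      ≤ (Fintype.card (Equiv.Perm (Fin m)) : ℝ≥0∞)⁻¹ * ∑ e : Equiv.Perm (Fin m),
        (ENNReal.ofReal (Real.exp ε) *
          swapPrefixLaw A (fun j => x' (Equiv.swap 0 i (σ e j))) (m + 1) le_rfl T +
            ENNReal.ofReal δ) := by
        gcongr with e
        refine h _ _ (fun j hj => hi _ fun h => hj ?_) T hT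
        rw [← Equiv.eq_symm_apply, Equiv.symm_swap, Equiv.swap_apply_right,
          ← hσ e] at h
        exact (σ e).injective h
    _ = _ := by
        rw [Finset.sum_add_distrib, ← Finset.mul_sum, mul_add]
        congr 1
        · ring
        · simp only [Finset.sum_const, Finset.card_univ, nsmul_eq_mul]
          rw [← mul_assoc, ENNReal.inv_mul_cancel hc0 (ENNReal.natCast_ne_top _), one_mul]

lemma IsDP.mono {X Y : Type*} [MeasurableSpace Y] {adj : X → X → Prop} {M : X → Measure Y}
    {ε ε' δ : ℝ} (h : IsDP adj M ε δ) (hε : ε ≤ ε') : IsDP adj M ε' δ :=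
  fun x x' hx T hT => (h x x' hx T hT).trans (by gcongr)

/-! ### The three bounds -/

lemma isDP_shuffledResponses [NeZero n] (A : LocalRandomizers 𝒟 S)
    [∀ i x, IsMarkovKernel (A i x)] {ε₀ ε₁ δ : ℝ} (hε₀ : 0 < ε₀) (hδ : 0 < δ)
    (hA : ∀ (i : Fin n) (z : Prefix S i i.is_lt.le),
      IsDP (fun _ _ : 𝒟 => True) (fun x => A i x z) ε₀ 0)
    (hε₁ : ε₁ = 2 * Real.exp (2 * ε₀) * (Real.exp ε₀ - 1) / n) :
    IsDP Adjacent (shuffledResponses A)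
      (ε₁ * √(2 * n * Real.log (1 / δ)) + n * ε₁ * (Real.exp ε₁ - 1)) δ := by
  have hn : (0 : ℝ) < n := by exact_mod_cast NeZero.pos n
  have hε₁pos : 0 < ε₁ := by
    have := Real.one_lt_exp_iff.2 hε₀
    have : 0 < Real.exp ε₀ - 1 := by linarith
    rw [hε₁]; positivity
  refine isDP_shuffledResponses_of_swap A fun x x' hx T hT => ?_
  rcases le_total 1 δ with h1 | h1
  · calc swapPrefixLaw A x n le_rfl T ≤ 1 := prob_le_one
      _ ≤ ENNReal.ofReal δ := by simpa using h1
      _ ≤ _ := le_add_self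
  set L := Real.log (1 / δ) with hL
  have hL0 : 0 ≤ L := Real.log_nonneg (by rw [le_div_iff₀ hδ]; linarith)
  set s := √(2 * n * L) with hs
  have hs0 : 0 ≤ s := Real.sqrt_nonneg _
  have hs2 : s ^ 2 = 2 * n * L := Real.sq_sqrt (by positivity)
  -- the order minimising the exponent `-l * ε₁ * s + n * l ^ 2 * ε₁ ^ 2 / 2`
  set l := s / (n * ε₁) with hl
  have hl0 : 0 ≤ l := by positivity
  refine ((hasMomentLE_swapPrefixLaw A hε₀ hl0 hA hε₁ hx n le_rfl).apply_le hl0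
    (ε₁ * s + n * ε₁ * (Real.exp ε₁ - 1)) hT).trans ?_
  gcongr
  rw [← ENNReal.ofReal_pow (Real.exp_pos _).le, ← ENNReal.ofReal_mul (Real.exp_pos _).le,
    ← Real.exp_nat_mul, ← Real.exp_add]
  refine ENNReal.ofReal_le_ofReal ?_
  have hδL : δ = Real.exp (-L) := by
    rw [hL, one_div, Real.log_inv, neg_neg, Real.exp_log hδ]
  conv_rhs => rw [hδL]
  refine Real.exp_le_exp.2 ?_
  have hls : l * (n * ε₁) = s := by rw [hl]; field_simp
  have h2 : l * ε₁ * s * n = 2 * n * L := by rw [← hs2, sq, ← hls]; ring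
  have h2' : l * ε₁ * s = 2 * L := by
    have := mul_right_cancel₀ hn.ne' (h2.trans (by ring : 2 * n * L = 2 * L * n))
    exact this
  have h3 : n * (l ^ 2 * ε₁ ^ 2) = 2 * L := by rw [← h2', ← hls]; ring
  have h4 : n * l * ε₁ * ε₁ ≤ n * l * ε₁ * (Real.exp ε₁ - 1) := by
    gcongr
    linarith [Real.add_one_le_exp ε₁]
  have h5 : 0 ≤ n * l * ε₁ * ε₁ := by positivity
  nlinarith

lemma exp_sub_one_le_of_le_half {x : ℝ} (hx0 : 0 ≤ x) (hx : x ≤ 1 / 2) :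
    Real.exp x - 1 ≤ 3 / 2 * x := by
  have h := Real.abs_exp_sub_one_sub_id_le (x := x) (by rw [abs_le]; constructor <;> linarith)
  have := (abs_le.1 h).2
  nlinarith

lemma isDP_shuffledResponses_of_le_log [NeZero n] (A : LocalRandomizers 𝒟 S)
    [∀ i x, IsMarkovKernel (A i x)] {ε₀ δ : ℝ} (hε₀ : 0 < ε₀) (hδ : 0 < δ)
    (hA : ∀ (i : Fin n) (z : Prefix S i i.is_lt.le),
      IsDP (fun _ _ : 𝒟 => True) (fun x => A i x z) ε₀ 0)
    (hle : ε₀ ≤ Real.log (n / 4) / 3) :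
    IsDP Adjacent (shuffledResponses A)
      (Real.exp (2 * ε₀) * (Real.exp ε₀ - 1) * √(8 * Real.log (1 / δ) / n) +
        6 * Real.exp (4 * ε₀) * (Real.exp ε₀ - 1) ^ 2 / n) δ := by
  have hn : (0 : ℝ) < n := by exact_mod_cast NeZero.pos n
  have ha : 0 < Real.exp ε₀ - 1 := by linarith [Real.one_lt_exp_iff.2 hε₀]
  refine (isDP_shuffledResponses A hε₀ hδ hA rfl).mono ?_
  set ε₁ := 2 * Real.exp (2 * ε₀) * (Real.exp ε₀ - 1) / n with hε₁
  have hε₁0 : 0 ≤ ε₁ := by positivity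
  have hhalf : ε₁ ≤ 1 / 2 := by
    have h3 : Real.exp (2 * ε₀) * Real.exp ε₀ ≤ n / 4 := by
      rw [← Real.exp_add, ← Real.le_log_iff_exp_le (by positivity)]
      linarith
    rw [hε₁, div_le_iff₀ hn]
    nlinarith [Real.exp_pos (2 * ε₀)]
  have hsqrt : √(2 * n * Real.log (1 / δ)) = n / 2 * √(8 * Real.log (1 / δ) / n) := by
    rw [show 2 * n * Real.log (1 / δ) = (n / 2) ^ 2 * (8 * Real.log (1 / δ) / n) by
      field_simp; ring, Real.sqrt_mul (by positivity), Real.sqrt_sq (by positivity)]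
  have h4 : Real.exp (4 * ε₀) = Real.exp (2 * ε₀) ^ 2 := by
    rw [← Real.exp_nat_mul]; congr 1; push_cast; ring
  refine add_le_add (le_of_eq ?_) ?_
  · rw [hsqrt, hε₁]
    field_simp
  · calc n * ε₁ * (Real.exp ε₁ - 1) ≤ n * ε₁ * (3 / 2 * ε₁) := by
          gcongr
          exact exp_sub_one_le_of_le_half hε₁0 hhalf
      _ = _ := by
          rw [hε₁, h4]
          field_simp
          ring

lemma isDP_shuffledResponses_of_lt_half [NeZero n] (A : LocalRandomizers 𝒟 S)
    [∀ i x, IsMarkovKernel (A i x)] {ε₀ δ : ℝ} (hε₀ : 0 < ε₀) (hδ : 0 < δ)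
    (hA : ∀ (i : Fin n) (z : Prefix S i i.is_lt.le),
      IsDP (fun _ _ : 𝒟 => True) (fun x => A i x z) ε₀ 0)
    (hn : 1000 ≤ n) (hhalf : ε₀ < 1 / 2) (hδ' : δ < 1 / 100) :
    IsDP Adjacent (shuffledResponses A) (12 * ε₀ * √(Real.log (1 / δ) / n)) δ := by
  have hnR : (1000 : ℝ) ≤ n := by exact_mod_cast hn
  have hn0 : (0 : ℝ) < n := by linarith
  have he1 := Real.exp_one_lt_d9
  have hL : 4 ≤ Real.log (1 / δ) := by
    rw [Real.le_log_iff_exp_le (by positivity), le_div_iff₀ hδ,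
      show (4 : ℝ) = (4 : ℕ) * 1 by norm_num, Real.exp_nat_mul]
    calc Real.exp 1 ^ 4 * δ ≤ 2.72 ^ 4 * (1 / 100) := by gcongr; linarith
      _ ≤ 1 := by norm_num
  refine (isDP_shuffledResponses_of_le_log A hε₀ hδ hA ?_).mono ?_
  · have : (3 / 2 : ℝ) ≤ Real.log (n / 4) := by
      rw [Real.le_log_iff_exp_le (by positivity)]
      calc Real.exp (3 / 2) ≤ Real.exp ((2 : ℕ) * 1) := Real.exp_le_exp.2 (by norm_num)
        _ = Real.exp 1 ^ 2 := by rw [Real.exp_nat_mul]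
        _ ≤ 2.72 ^ 2 := by gcongr; linarith
        _ ≤ n / 4 := by linarith
    linarith
  set t := √(Real.log (1 / δ) / n) with ht
  have ht0 : 0 ≤ t := Real.sqrt_nonneg _
  have htn : 63 / n ≤ t := by
    rw [ht]
    refine Real.le_sqrt_of_sq_le ?_
    rw [div_pow, div_le_div_iff₀ (by positivity) hn0]
    nlinarith
  have h8 : √(8 * Real.log (1 / δ) / n) ≤ 2.83 * t := by
    rw [mul_div_assoc, Real.sqrt_mul (by norm_num)]
    gcongr
    rw [Real.sqrt_le_left (by norm_num)]
    norm_num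
  -- `exp (1 / 2) < 1.65`, and by convexity `exp` lies below its chord on `[0, 1 / 2]`
  have hsq : Real.exp (1 / 2) ≤ 1.65 := by
    refine (sq_le_sq₀ (Real.exp_pos _).le (by norm_num)).1 ?_
    rw [← Real.exp_nat_mul]
    norm_num
    linarith
  have hchord : Real.exp ε₀ - 1 ≤ 1.3 * ε₀ := by
    have := convexOn_exp.2 (Set.mem_univ (0 : ℝ)) (Set.mem_univ (1 / 2 : ℝ))
      (show 0 ≤ 1 - 2 * ε₀ by linarith) (show 0 ≤ 2 * ε₀ by linarith) (by ring)
    simp only [smul_eq_mul, Real.exp_zero] at this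
    rw [show (1 - 2 * ε₀) * 0 + 2 * ε₀ * (1 / 2) = ε₀ by ring] at this
    nlinarith
  have ha : 0 ≤ Real.exp ε₀ - 1 := by linarith [Real.one_lt_exp_iff.2 hε₀]
  have hE : Real.exp (2 * ε₀) ≤ 2.72 :=
    (Real.exp_le_exp.2 (by linarith : 2 * ε₀ ≤ 1)).trans (by linarith)
  have h4 : Real.exp (4 * ε₀) = Real.exp (2 * ε₀) ^ 2 := by
    rw [← Real.exp_nat_mul]; congr 1; push_cast; ring
  calc Real.exp (2 * ε₀) * (Real.exp ε₀ - 1) * √(8 * Real.log (1 / δ) / n) +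
        6 * Real.exp (4 * ε₀) * (Real.exp ε₀ - 1) ^ 2 / n
      ≤ 2.72 * (1.3 * ε₀) * (2.83 * t) + 6 * 2.72 ^ 2 * (1.3 * ε₀) ^ 2 / n := by
        rw [h4]; gcongr
    _ = 2.72 * (1.3 * ε₀) * (2.83 * t) + 6 * 2.72 ^ 2 * 1.3 ^ 2 / 63 * ε₀ * ε₀ * (63 / n) := by
        field_simp
    _ ≤ 2.72 * (1.3 * ε₀) * (2.83 * t) + 6 * 2.72 ^ 2 * 1.3 ^ 2 / 63 * ε₀ * (1 / 2) * t := by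
        gcongr
    _ ≤ 12 * ε₀ * t := by nlinarith [mul_nonneg hε₀.le ht0]

end ShuffleDP

theorem theorem3p3 {n : ℕ} (hn : 1 < n) {𝒟 : Type*} {S : Fin n → Type*}
    [∀ i, MeasurableSpace (S i)] (A : ShuffleDP.LocalRandomizers 𝒟 S)
    [∀ i x, IsMarkovKernel (A i x)] (ε₀ δ ε₁ : ℝ) (hε₀ : 0 < ε₀) (hδ : 0 < δ)
    (hA : ∀ (i : Fin n) (z : ShuffleDP.Prefix S i i.is_lt.le),
      ShuffleDP.IsDP (fun _ _ : 𝒟 => True) (fun x => A i x z) ε₀ 0)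
    (hε₁ : ε₁ = 2 * Real.exp (2 * ε₀) * (Real.exp ε₀ - 1) / n) :
    ShuffleDP.IsDP ShuffleDP.Adjacent (ShuffleDP.shuffledResponses A)
      (ε₁ * √(2 * n * Real.log (1 / δ)) + n * ε₁ * (Real.exp ε₁ - 1)) δ ∧
    (ε₀ ≤ Real.log (n / 4) / 3 →
      ShuffleDP.IsDP ShuffleDP.Adjacent (ShuffleDP.shuffledResponses A)
        (Real.exp (2 * ε₀) * (Real.exp ε₀ - 1) * √(8 * Real.log (1 / δ) / n) +
          6 * Real.exp (4 * ε₀) * (Real.exp ε₀ - 1) ^ 2 / n) δ) ∧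
    (1000 ≤ n → ε₀ < 1 / 2 → δ < 1 / 100 →
      ShuffleDP.IsDP ShuffleDP.Adjacent (ShuffleDP.shuffledResponses A)
        (12 * ε₀ * √(Real.log (1 / δ) / n)) δ) := by
  have : NeZero n := ⟨by omega⟩
  exact ⟨ShuffleDP.isDP_shuffledResponses A hε₀ hδ hA hε₁,
    ShuffleDP.isDP_shuffledResponses_of_le_log A hε₀ hδ hA,
    ShuffleDP.isDP_shuffledResponses_of_lt_half A hε₀ hδ hA⟩
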